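/- Let $\mathcal{S}$ be a non-empty connected $\mathcal{C}^1$ surface of the Euclidean space $\mathbb{R}^3$ (an embedded two-dimensional $\mathcal{C}^1$ submanifold without boundary, not necessarily closed in $\mathbb{R}^3$). For an affine line $\Delta \subset \mathbb{R}^3$ oriented by a unit vector $u$ and a real number $\lambda$, we say that $\mathcal{S}$ presents the helical symmetry of axis $\Delta$ and of shift $2\pi\lambda$ if, for every $x \in \mathcal{S}$ and every $\theta \in \mathbb{R}$, the point $\mathcal{R}_{\Delta,\theta}(x) + \lambda\theta u$ belongs to $\mathcal{S}$, where $\mathcal{R}_{\Delta,\theta}$ is the affine rotation of angle $\theta$ around the oriented line $\Delta$. (The case $\lambda = 0$ is allowed, and reversing the orientation of $\Delta$ does not change the notion.) A cylinder of revolution is the union of all the images of a line $d$ under the rotations around an axis parallel to $d$ and distinct from $d$. Assume that $\mathcal{S}$ is not a plane, and that it presents two different helical symmetries, that is, a helical symmetry of axis $\Delta_1$ and of shift $s_1$ and a helical symmetry of axis $\Delta_2$ and of shift $s_2$, with $\Delta_1 \neq \Delta_2$ or $s_1 \neq s_2$. Then $\mathcal{S}$ is either a cylinder of revolution or a sphere.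 -/

import Mathlib

open scoped RealInnerProductSpace

/-- Three-dimensional Euclidean space. -/
abbrev E3 : Type := EuclideanSpace ℝ (Fin 3)

/-- The vector product of two vectors of Euclidean space. -/
noncomputable def cross3 (u v : E3) : E3 :=
  WithLp.toLp 2 (crossProduct (WithLp.ofLp u) (WithLp.ofLp v))

/-- The affine line through `a` directed by `u` (a line as soon as `u ≠ 0`). -/
noncomputable def lineThrough (a u : E3) : AffineSubspace ℝ E3 :=
  AffineSubspace.mk' a (Submodule.span ℝ {u})

/-- The affine rotation of angle `θ` around the line through `a` oriented by the unit vector `u`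
(Rodrigues' formula). -/
noncomputable def axisRotation (a u : E3) (θ : ℝ) (x : E3) : E3 :=
  a + (Real.cos θ • (x - a) + Real.sin θ • cross3 u (x - a)
    + ((1 - Real.cos θ) * ⟪u, x - a⟫) • u)

/-- The screw motion: rotation of angle `θ` around the oriented axis, followed by the translation
of vector `lam θ u` along that axis. -/
noncomputable def screwMotion (a u : E3) (lam θ : ℝ) (x : E3) : E3 :=
  axisRotation a u θ x + (lam * θ) • u

/-- `S` is a `C¹` surface (an embedded two-dimensional `C¹` submanifold without boundary, not
necessarily closed): around each of its points, it is the zero set of a `C¹` function whose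
differential does not vanish. -/
def IsC1Surface (S : Set E3) : Prop :=
  ∀ x ∈ S, ∃ (U : Set E3) (f : E3 → ℝ), IsOpen U ∧ x ∈ U ∧ ContDiffOn ℝ 1 f U ∧
    (∀ y ∈ U, fderiv ℝ f y ≠ 0) ∧ S ∩ U = {y ∈ U | f y = 0}

/-- `S` presents the helical symmetry of axis `Δ` and of shift `s = 2 π lam`. Reversing the
orientation `u` of the axis amounts to replacing `θ` by `-θ`, so that the choice of `a` and `u`
representing `Δ` does not matter. -/
def HasHelicalSymmetry (S : Set E3) (Δ : AffineSubspace ℝ E3) (s : ℝ) : Prop :=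
  ∃ (a u : E3) (lam : ℝ), ‖u‖ = 1 ∧ Δ = lineThrough a u ∧ s = 2 * Real.pi * lam ∧
    ∀ x ∈ S, ∀ θ : ℝ, screwMotion a u lam θ x ∈ S

/-- `S` is an affine plane. -/
def IsAffinePlane (S : Set E3) : Prop :=
  ∃ P : AffineSubspace ℝ E3, Module.finrank ℝ P.direction = 2 ∧ S = (P : Set E3)

/-- `S` is a sphere (of positive radius). -/
def IsRoundSphere (S : Set E3) : Prop :=
  ∃ (c : E3) (r : ℝ), 0 < r ∧ S = Metric.sphere c r

/-- `S` is a cylinder of revolution: the union of all the rotated copies of a line (through `b`,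
directed by `u`) around an axis (through `a`, directed by `u`) parallel to and distinct from that
line. -/
def IsCylinderOfRevolution (S : Set E3) : Prop :=
  ∃ a u b : E3, ‖u‖ = 1 ∧ b ∉ lineThrough a u ∧
    S = ⋃ θ : ℝ, axisRotation a u θ '' (lineThrough b u : Set E3)

/-!
A helical symmetry of `S` gives a one-parameter group of screw motions preserving `S`. Together, two
different ones generate so many rigid motions that `S` is a union of level sets of one of three
functions: a linear form, the distance to a line, or the distance to a point. A connected surface
which is a union of level sets of a continuous function is a single level set
(`IsC1Surface.eq_level_set`), because an interval of values would give it an interior. As a surface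
is not contained in a line (`IsC1Surface.exists_not_mem_line`), the level set is not degenerate.

* Same axis, different shifts: composing a screw motion with the inverse of another gives the
  translations along the axis, hence also the rotations, and `S` is a cylinder of revolution
  (`IsC1Surface.isCylinderOfRevolution`).
* Distinct parallel axes: the same compositions, conjugated by rotations, give all the translations
  orthogonal to the axes (`mem_translationVectors_of_parallel`), so `S` is a plane.
* Non-parallel axes: the infinitesimal rigid motions tangent to `S` form a vector space which is
  stable under bracket with the two generators (`IsScrewInvariant.bracket_mem`). If it contained a
  non-zero translation it would contain them all, and the tangent spaces of `S` would be
  three-dimensional (`IsC1Surface.translation_eq_zero`). As the directions `u₁`, `u₂` of the axes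
  satisfy `u₁ × (u₁ × u₂) = ⟨u₁, u₂⟩ u₁ - u₂`, the corresponding combination of iterated brackets is
  a translation, hence zero; this forces both screw motions to be rotations
  (`IsC1Surface.lam_eq_zero_of_cross3_ne_zero`) and the axes to meet. Rotations around two lines
  meeting at a point act transitively on the spheres centred there (`sphere_transitive`), so `S` is
  a sphere.
-/

/-! ### Vector product -/

theorem E3.ext_coord {x y : E3} (h0 : x 0 = y 0) (h1 : x 1 = y 1) (h2 : x 2 = y 2) : x = y := by
  ext i
  fin_cases i
  exacts [h0, h1, h2]

theorem inner_coord (x y : E3) : ⟪x, y⟫ = x 0 * y 0 + x 1 * y 1 + x 2 * y 2 := by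
  simp [PiLp.inner_apply, Fin.sum_univ_three, mul_comm]

@[simp] theorem cross3_zero_coord (u v : E3) : cross3 u v 0 = u 1 * v 2 - u 2 * v 1 := by
  simp [cross3, cross_apply]

@[simp] theorem cross3_one_coord (u v : E3) : cross3 u v 1 = u 2 * v 0 - u 0 * v 2 := by
  simp [cross3, cross_apply]

@[simp] theorem cross3_two_coord (u v : E3) : cross3 u v 2 = u 0 * v 1 - u 1 * v 0 := by
  simp [cross3, cross_apply]

theorem cross3_add_right (u v w : E3) : cross3 u (v + w) = cross3 u v + cross3 u w := by
  apply E3.ext_coord <;> simp <;> ring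

theorem cross3_smul_right (u : E3) (c : ℝ) (v : E3) : cross3 u (c • v) = c • cross3 u v := by
  apply E3.ext_coord <;> simp <;> ring

theorem cross3_sub_right (u v w : E3) : cross3 u (v - w) = cross3 u v - cross3 u w := by
  apply E3.ext_coord <;> simp <;> ring

theorem cross3_add_left (u v w : E3) : cross3 (u + v) w = cross3 u w + cross3 v w := by
  apply E3.ext_coord <;> simp <;> ring

theorem cross3_smul_left (c : ℝ) (u v : E3) : cross3 (c • u) v = c • cross3 u v := by
  apply E3.ext_coord <;> simp <;> ring

theorem cross3_neg_left (u v : E3) : cross3 (-u) v = -cross3 u v := by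
  apply E3.ext_coord <;> simp <;> ring

theorem cross3_swap (u v : E3) : cross3 u v = -cross3 v u := by
  apply E3.ext_coord <;> simp <;> ring

@[simp] theorem cross3_self (u : E3) : cross3 u u = 0 := by
  apply E3.ext_coord <;> simp <;> ring

@[simp] theorem cross3_zero_left (u : E3) : cross3 0 u = 0 := by
  apply E3.ext_coord <;> simp

@[simp] theorem cross3_zero_right (u : E3) : cross3 u 0 = 0 := by
  apply E3.ext_coord <;> simp

@[simp] theorem inner_self_cross3 (u v : E3) : ⟪u, cross3 u v⟫ = 0 := by
  simp [inner_coord]; ring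

@[simp] theorem inner_cross3_self (u v : E3) : ⟪v, cross3 u v⟫ = 0 := by
  simp [inner_coord]; ring

theorem cross3_cross3 (u v w : E3) : cross3 u (cross3 v w) = ⟪u, w⟫ • v - ⟪u, v⟫ • w := by
  apply E3.ext_coord <;> simp [inner_coord] <;> ring

theorem cross3_cross3_left (u v w : E3) : cross3 (cross3 u v) w = ⟪u, w⟫ • v - ⟪v, w⟫ • u := by
  apply E3.ext_coord <;> simp [inner_coord] <;> ring

theorem inner_cross3_cross3 (u v w z : E3) :
    ⟪cross3 u v, cross3 w z⟫ = ⟪u, w⟫ * ⟪v, z⟫ - ⟪u, z⟫ * ⟪v, w⟫ := by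
  simp [inner_coord]; ring

theorem inner_cross3_rotate (u v w : E3) : ⟪u, cross3 v w⟫ = ⟪v, cross3 w u⟫ := by
  simp [inner_coord]; ring

theorem inner_self_of_norm_one {u : E3} (hu : ‖u‖ = 1) : ⟪u, u⟫ = 1 := by
  rw [real_inner_self_eq_norm_sq, hu, one_pow]

/-- A vector whose product with the unit vector `u` vanishes is proportional to `u`. -/
theorem eq_smul_of_cross3_eq_zero {u v : E3} (hu : ‖u‖ = 1) (h : cross3 u v = 0) :
    v = ⟪u, v⟫ • u := by
  have := cross3_cross3 u u v
  rw [h, cross3_zero_right, inner_self_of_norm_one hu, one_smul] at this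
  exact (sub_eq_zero.1 this.symm).symm

theorem norm_sq_cross3_unit {u : E3} (hu : ‖u‖ = 1) (v : E3) :
    ⟪cross3 u v, cross3 u v⟫ = ⟪v, v⟫ - ⟪u, v⟫ ^ 2 := by
  rw [inner_cross3_cross3, inner_self_of_norm_one hu, real_inner_comm u v]; ring

theorem continuous_cross3 (u : E3) : Continuous (cross3 u) :=
  (LinearMap.mk (AddHom.mk (cross3 u) (cross3_add_right u))
    (cross3_smul_right u) : E3 →ₗ[ℝ] E3).continuous_of_finiteDimensional

/-- The vector product by `u` on the left, as a continuous linear map. -/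
noncomputable def crossCLM (u : E3) : E3 →L[ℝ] E3 where
  toFun := cross3 u
  map_add' := cross3_add_right u
  map_smul' := cross3_smul_right u
  cont := continuous_cross3 u

@[simp] theorem crossCLM_apply (u v : E3) : crossCLM u v = cross3 u v := rfl

/-! ### Vector rotations -/

/-- The linear part of `axisRotation`: the vector rotation of angle `θ` around `u`. -/
noncomputable def rot (u : E3) (θ : ℝ) : E3 →L[ℝ] E3 :=
  Real.cos θ • ContinuousLinearMap.id ℝ E3 + Real.sin θ • crossCLM u
    + (1 - Real.cos θ) • (innerSL ℝ u).smulRight u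

theorem rot_apply (u : E3) (θ : ℝ) (v : E3) :
    rot u θ v = Real.cos θ • v + Real.sin θ • cross3 u v + ((1 - Real.cos θ) * ⟪u, v⟫) • u := by
  simp [rot, smul_smul]

theorem axisRotation_eq (a u : E3) (θ : ℝ) (x : E3) :
    axisRotation a u θ x = a + rot u θ (x - a) := by
  rw [rot_apply]; rfl

theorem screwMotion_eq (a u : E3) (lam θ : ℝ) (x : E3) :
    screwMotion a u lam θ x = a + rot u θ (x - a) + (lam * θ) • u := by
  rw [screwMotion, axisRotation_eq]

theorem rot_self {u : E3} (hu : ‖u‖ = 1) (θ : ℝ) : rot u θ u = u := by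
  rw [rot_apply, cross3_self, inner_self_of_norm_one hu]; module

theorem inner_rot {u : E3} (hu : ‖u‖ = 1) (θ : ℝ) (v : E3) : ⟪u, rot u θ v⟫ = ⟪u, v⟫ := by
  rw [rot_apply]
  simp only [inner_add_right, real_inner_smul_right, inner_self_cross3,
    inner_self_of_norm_one hu]
  ring

theorem rot_zero (u v : E3) : rot u 0 v = v := by
  simp [rot_apply]

theorem rot_neg_axis (u : E3) (θ : ℝ) (v : E3) : rot (-u) (-θ) v = rot u θ v := by
  simp [rot_apply, cross3_neg_left]

theorem rot_rot {u : E3} (hu : ‖u‖ = 1) (θ φ : ℝ) (v : E3) :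
    rot u θ (rot u φ v) = rot u (θ + φ) v := by
  rw [rot_apply u θ, inner_rot hu, rot_apply u φ v, rot_apply u (θ + φ) v]
  simp only [cross3_add_right, cross3_smul_right, cross3_cross3, cross3_self,
    inner_self_of_norm_one hu, Real.cos_add, Real.sin_add]
  module

theorem rot_rot_neg {u : E3} (hu : ‖u‖ = 1) (θ : ℝ) (v : E3) : rot u θ (rot u (-θ) v) = v := by
  rw [rot_rot hu, add_neg_cancel, rot_zero]

theorem inner_self_rot (u : E3) (θ : ℝ) (v : E3) :
    ⟪v, rot u θ v⟫ = Real.cos θ * ⟪v, v⟫ + (1 - Real.cos θ) * ⟪u, v⟫ ^ 2 := by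
  rw [rot_apply]
  simp only [inner_add_right, real_inner_smul_right, inner_cross3_self, real_inner_comm u v]
  ring

theorem norm_sq_rot {u : E3} (hu : ‖u‖ = 1) (θ : ℝ) (v : E3) :
    ⟪rot u θ v, rot u θ v⟫ = ⟪v, v⟫ := by
  have h1 := inner_rot hu θ v
  have hc := norm_sq_cross3_unit hu v
  have hv := inner_self_rot u θ v
  have hw : ⟪cross3 u v, rot u θ v⟫ = Real.sin θ * (⟪v, v⟫ - ⟪u, v⟫ ^ 2) := by
    rw [rot_apply]
    simp only [inner_add_right, real_inner_smul_right, hc, real_inner_comm v (cross3 u v),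
      real_inner_comm u (cross3 u v), inner_cross3_self, inner_self_cross3]
    ring
  conv_lhs => arg 2; rw [rot_apply]
  simp only [inner_add_left, real_inner_smul_left, h1, hv, hw]
  linear_combination (⟪v, v⟫ - ⟪u, v⟫ ^ 2) * Real.sin_sq_add_cos_sq θ

/-- The rotations around `u` act transitively on the vectors of given norm and given component
along `u`. -/
theorem exists_rot_eq {u v w : E3} (hu : ‖u‖ = 1) (hn : ⟪v, v⟫ = ⟪w, w⟫) (hh : ⟪u, v⟫ = ⟪u, w⟫) :
    ∃ θ : ℝ, rot u θ v = w := by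
  set D := ⟪v, v⟫ - ⟪u, v⟫ ^ 2 with hD
  have hv := norm_sq_cross3_unit hu v
  have hw := norm_sq_cross3_unit hu w
  have huu := inner_self_of_norm_one hu
  by_cases h0 : D = 0
  · have e1 : cross3 u v = 0 := inner_self_eq_zero (𝕜 := ℝ).1 (by rw [hv, ← hD, h0])
    have e2 : cross3 u w = 0 :=
      inner_self_eq_zero (𝕜 := ℝ).1 (by rw [hw, ← hn, ← hh, ← hD, h0])
    refine ⟨0, ?_⟩
    rw [rot_zero, eq_smul_of_cross3_eq_zero hu e1, eq_smul_of_cross3_eq_zero hu e2, hh]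
  · -- `C` and `N` are the cosine and the sine of the angle between the components orthogonal to `u`
    set C := (⟪v, w⟫ - ⟪u, v⟫ ^ 2) / D with hC
    set N := ⟪w, cross3 u v⟫ / D with hN
    -- the components `p`, `q` of `v`, `w` orthogonal to `u` have a product parallel to `u`, and
    -- expanding `p × (p × q)` gives the decomposition of `w` along `v`, `u × v` and `u`
    have key : D • w = (⟪v, w⟫ - ⟪u, v⟫ ^ 2) • v + ⟪w, cross3 u v⟫ • cross3 u v
        + ((D - (⟪v, w⟫ - ⟪u, v⟫ ^ 2)) * ⟪u, v⟫) • u := by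
      set p := v - ⟪u, v⟫ • u with hp
      set q := w - ⟪u, w⟫ • u with hq
      have hpu : ⟪u, p⟫ = 0 := by
        rw [hp, inner_sub_right, real_inner_smul_right, huu]; ring
      have hqu : ⟪u, q⟫ = 0 := by
        rw [hq, inner_sub_right, real_inner_smul_right, huu]; ring
      have hpq0 : cross3 u (cross3 p q) = 0 := by
        rw [cross3_cross3, hpu, hqu]; simp
      have hpq := eq_smul_of_cross3_eq_zero hu hpq0
      have h3 := cross3_cross3 p p q
      rw [hpq, cross3_smul_right] at h3
      have e1 : ⟪u, cross3 p q⟫ = ⟪w, cross3 u v⟫ := by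
        rw [inner_cross3_rotate, inner_cross3_rotate, hp, hq]
        simp only [inner_sub_left, cross3_sub_right, cross3_smul_right, cross3_self, smul_zero,
          sub_zero, real_inner_smul_left, inner_self_cross3, mul_zero]
      have e2 : cross3 p u = - cross3 u v := by
        rw [cross3_swap, hp, cross3_sub_right, cross3_smul_right, cross3_self]; simp
      have e3 : ⟪p, p⟫ = D := by
        rw [hp]
        simp only [inner_sub_left, inner_sub_right, real_inner_smul_left, real_inner_smul_right,
          huu, real_inner_comm u v, hD]
        ring
      have e4 : ⟪p, q⟫ = ⟪v, w⟫ - ⟪u, v⟫ ^ 2 := by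
        rw [hp, hq]
        simp only [inner_sub_left, inner_sub_right, real_inner_smul_left, real_inner_smul_right,
          huu, real_inner_comm u v, ← hh]
        ring
      rw [e1, e2, e3, e4, hq, hp, ← hh] at h3
      linear_combination (norm := module) h3
    have hCN : C ^ 2 + N ^ 2 = 1 := by
      have h := congrArg (fun z => ⟪w, z⟫) key
      simp only [inner_add_right, real_inner_smul_right, ← hn, real_inner_comm v w,
        real_inner_comm u w, ← hh] at h
      have : (⟪v, w⟫ - ⟪u, v⟫ ^ 2) ^ 2 + ⟪w, cross3 u v⟫ ^ 2 = D ^ 2 := by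
        linear_combination -h + D * hD
      rw [hC, hN, div_pow, div_pow, ← add_div, this, div_self (pow_ne_zero 2 h0)]
    obtain ⟨θ, hc, hs⟩ : ∃ θ : ℝ, Real.cos θ = C ∧ Real.sin θ = N := by
      have hz : ‖(⟨C, N⟩ : ℂ)‖ = 1 := by
        rw [Complex.norm_def, Complex.normSq_mk, ← sq, ← sq, hCN, Real.sqrt_one]
      have hz0 : (⟨C, N⟩ : ℂ) ≠ 0 := by
        rw [← norm_ne_zero_iff, hz]; exact one_ne_zero
      exact ⟨Complex.arg ⟨C, N⟩, by rw [Complex.cos_arg hz0, hz, div_one],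
        by rw [Complex.sin_arg, hz, div_one]⟩
    refine ⟨θ, smul_right_injective E3 h0 ?_⟩
    simp only
    rw [key, rot_apply, hc, hs, smul_add, smul_add, smul_smul, smul_smul, smul_smul, hC, hN,
      mul_div_cancel₀ _ h0, mul_div_cancel₀ _ h0, ← mul_assoc, mul_sub, mul_div_cancel₀ _ h0,
      mul_one]

/-! ### Tangent vectors and elementary properties of surfaces -/

/-- The vectors tangent to an arbitrary set `S` at `x`: those killed by the differential at `x` of
every function that is differentiable at `x` and vanishes on `S` near `x`. For a surface this is
contained in the tangent plane. -/
def tangentVectors (S : Set E3) (x : E3) : Submodule ℝ E3 where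
  carrier := {v | ∀ f : E3 → ℝ, DifferentiableAt ℝ f x →
    (∀ᶠ y in nhdsWithin x S, f y = 0) → fderiv ℝ f x v = 0}
  add_mem' := fun hv hw f hf h0 => by rw [map_add, hv f hf h0, hw f hf h0, add_zero]
  zero_mem' := fun f _ _ => map_zero _
  smul_mem' := fun c v hv f hf h0 => by rw [map_smul, hv f hf h0, smul_zero]

theorem IsC1Surface.tangentVectors_ne_top {S : Set E3} (hS : IsC1Surface S) {x : E3}
    (hx : x ∈ S) : tangentVectors S x ≠ ⊤ := by
  obtain ⟨U, f, hU, hxU, hf, hd, hSU⟩ := hS x hx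
  intro htop
  apply hd x hxU
  ext v
  have hv : v ∈ tangentVectors S x := htop ▸ Submodule.mem_top
  refine hv f ((hf.contDiffAt (hU.mem_nhds hxU)).differentiableAt one_ne_zero) ?_
  filter_upwards [self_mem_nhdsWithin, mem_nhdsWithin_of_mem_nhds (hU.mem_nhds hxU)] with y h1 h2
  exact (hSU ▸ (⟨h1, h2⟩ : y ∈ S ∩ U) : y ∈ {y ∈ U | f y = 0}).2

/-- The velocity of a curve drawn on `S` is tangent to `S`. -/
theorem velocity_mem_tangentVectors {S : Set E3} {γ : ℝ → E3} {v : E3} (hγ : HasDerivAt γ v 0)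
    (hS : ∀ θ, γ θ ∈ S) : v ∈ tangentVectors S (γ 0) := by
  intro f hf h0
  have h1 : HasDerivAt (f ∘ γ) (fderiv ℝ f (γ 0) v) 0 := hf.hasFDerivAt.comp_hasDerivAt 0 hγ
  have ht : Filter.Tendsto γ (nhds 0) (nhdsWithin (γ 0) S) :=
    tendsto_nhdsWithin_iff.2 ⟨hγ.continuousAt, Filter.Eventually.of_forall hS⟩
  have h2 : HasDerivAt (f ∘ γ) 0 0 :=
    (hasDerivAt_const (0 : ℝ) (0 : ℝ)).congr_of_eventuallyEq (ht.eventually h0)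
  exact h1.unique h2

/-- Tangent vectors are pushed forward by the maps preserving `S`. -/
theorem tangentVectors_map {S : Set E3} {g : E3 → E3} {A : E3 →L[ℝ] E3} {x v : E3}
    (hg : HasFDerivAt g A x) (hS : Set.MapsTo g S S) (hv : v ∈ tangentVectors S x) :
    A v ∈ tangentVectors S (g x) := by
  intro f hf h0
  have h1 : HasFDerivAt (f ∘ g) ((fderiv ℝ f (g x)).comp A) x := hf.hasFDerivAt.comp x hg
  have h2 := hv (f ∘ g) h1.differentiableAt ((hg.continuousAt.continuousWithinAt.tendsto_nhdsWithin
    hS).eventually h0)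
  rwa [h1.fderiv] at h2

/-- A curve of tangent vectors at a fixed point has a tangent derivative. -/
theorem deriv_mem_tangentVectors {S : Set E3} {x : E3} {c : ℝ → E3} {v : E3}
    (hc : HasDerivAt c v 0) (h : ∀ θ, c θ ∈ tangentVectors S x) : v ∈ tangentVectors S x := by
  intro f hf h0
  have h1 : HasDerivAt (fun θ => fderiv ℝ f x (c θ)) (fderiv ℝ f x v) 0 :=
    (fderiv ℝ f x).hasFDerivAt.comp_hasDerivAt 0 hc
  have h2 : (fun θ => fderiv ℝ f x (c θ)) = fun _ => 0 := funext fun θ => h θ f hf h0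
  rw [h2] at h1
  exact h1.unique (hasDerivAt_const _ _)

theorem IsC1Surface.not_subset_of_isOpen {S V : Set E3} (hS : IsC1Surface S) (hV : IsOpen V)
    (hne : V.Nonempty) : ¬ V ⊆ S := by
  intro hVS
  obtain ⟨x, hx⟩ := hne
  apply hS.tangentVectors_ne_top (hVS hx)
  rw [eq_top_iff]
  intro v _ f hf h0
  have h1 : f =ᶠ[nhds x] fun _ => 0 := by
    rwa [nhdsWithin_eq_nhds.2 (Filter.mem_of_superset (hV.mem_nhds hx) hVS)] at h0
  rw [h1.fderiv_eq]
  simp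

/-- A connected surface that is a union of level sets of a continuous function is a single level
set: otherwise the function takes an interval of values on it, and the surface has an interior. -/
theorem IsC1Surface.eq_level_set {S : Set E3} (hS : IsC1Surface S) (hconn : IsConnected S)
    {h : E3 → ℝ} (hc : Continuous h) (hsat : ∀ x ∈ S, ∀ y, h y = h x → y ∈ S) {x : E3}
    (hx : x ∈ S) : S = {y | h y = h x} := by
  apply Set.Subset.antisymm _ fun y hy => hsat x hx y hy
  have hord := (hconn.isPreconnected.image h hc.continuousOn).ordConnected
  have key : ∀ y ∈ S, ∀ z ∈ S, ¬ h y < h z := by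
    intro y hy z hz hlt
    have himg : Set.Icc (h y) (h z) ⊆ h '' S := hord.out ⟨y, hy, rfl⟩ ⟨z, hz, rfl⟩
    refine hS.not_subset_of_isOpen (isOpen_Ioo.preimage hc : IsOpen (h ⁻¹' Set.Ioo (h y) (h z)))
      ?_ ?_
    · obtain ⟨c, hc1, hc2⟩ := exists_between hlt
      obtain ⟨w, -, hw⟩ := himg ⟨hc1.le, hc2.le⟩
      exact ⟨w, by simp [hw, hc1, hc2]⟩
    · intro w hw
      obtain ⟨w', hw', he⟩ := himg (Set.Ioo_subset_Icc_self hw)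
      exact hsat w' hw' w he.symm
  intro y hy
  exact le_antisymm (not_lt.1 (key x hx y hy)) (not_lt.1 (key y hy x hx))

/-- A surface is not contained in a line: a function which is a submersion at a point of the line
changes sign along a half circle avoiding the line. -/
theorem IsC1Surface.exists_not_mem_line {S : Set E3} (hS : IsC1Surface S) {x u : E3} (hx : x ∈ S)
    (hu : ‖u‖ = 1) : ∃ y ∈ S, cross3 u (y - x) ≠ 0 := by
  by_contra! hline
  obtain ⟨U, f, hU, hxU, hf, hd, hSU⟩ := hS x hx
  have hfx : f x = 0 := (hSU ▸ (⟨hx, hxU⟩ : x ∈ S ∩ U) : x ∈ {y ∈ U | f y = 0}).2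
  have hdf := ((hf.contDiffAt (hU.mem_nhds hxU)).differentiableAt one_ne_zero).hasFDerivAt
  set l := fderiv ℝ f x with hl
  -- a vector not parallel to the line along which `f` is increasing
  obtain ⟨v, hv, huv⟩ : ∃ v, 0 < l v ∧ cross3 u v ≠ 0 := by
    obtain ⟨w, hw⟩ : ∃ w, l w ≠ 0 := by
      by_contra! h0
      exact hd x hxU (ContinuousLinearMap.ext h0)
    obtain ⟨w, hw⟩ : ∃ w, 0 < l w := by
      rcases lt_or_gt_of_ne hw with h | h
      · exact ⟨-w, by rw [map_neg]; linarith⟩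
      · exact ⟨w, h⟩
    by_cases huw : cross3 u w = 0
    · obtain ⟨p, hp⟩ : ∃ p, cross3 u p ≠ 0 := by
        by_contra! h0
        have h2 : ∀ p : E3, p = ⟪u, p⟫ • u := fun p => eq_smul_of_cross3_eq_zero hu (h0 p)
        have h3 : Module.finrank ℝ E3 ≤ 1 := finrank_le_one u fun p => ⟨⟪u, p⟫, (h2 p).symm⟩
        rw [finrank_euclideanSpace_fin] at h3
        omega
      by_cases hlp : 0 ≤ l p
      · exact ⟨w + p, by rw [map_add]; linarith, by rwa [cross3_add_right, huw, zero_add]⟩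
      · refine ⟨w - p, by rw [map_sub]; linarith, ?_⟩
        rwa [cross3_sub_right, huw, zero_sub, neg_ne_zero]
    · exact ⟨w, hw, huw⟩
  obtain ⟨r, hr, hball⟩ := Metric.isOpen_iff.1 hU x hxU
  have hsign : ∀ᶠ t in nhdsWithin (0 : ℝ) (Set.Ioi 0), 0 < f (x + t • v) ∧ f (x + t • (-v)) < 0 := by
    have hder : ∀ w : E3, HasDerivAt (fun t : ℝ => f (x + t • w)) (l w) 0 := by
      intro w
      have h1 : HasDerivAt (fun t : ℝ => x + t • w) w 0 := by
        simpa using ((hasDerivAt_id (0 : ℝ)).smul_const w).const_add x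
      have h2 : HasFDerivAt f l (x + (0 : ℝ) • w) := by simpa using hdf
      exact h2.comp_hasDerivAt 0 h1
    have hs : ∀ w : E3, 0 < l w → ∀ g : ℝ → ℝ, HasDerivAt g (l w) 0 → g 0 = 0 →
        ∀ᶠ t in nhdsWithin (0 : ℝ) (Set.Ioi 0), 0 < g t := by
      intro w hw g hg hg0
      have h1 := (hasDerivAt_iff_tendsto_slope.1 hg).mono_left
        (nhdsWithin_mono (0 : ℝ) (fun t (ht : 0 < t) => ht.ne'))
      filter_upwards [h1.eventually (lt_mem_nhds hw), self_mem_nhdsWithin] with t ht ht0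
      rw [slope_def_field, hg0, sub_zero, sub_zero] at ht
      exact (div_pos_iff_of_pos_right ht0).1 ht
    have hneg : HasDerivAt (fun t : ℝ => -f (x + t • (-v))) (l v) 0 := by
      exact (hder (-v)).neg.congr_deriv (by simp)
    filter_upwards [hs v hv _ (hder v) (by simp [hfx]), hs v hv _ hneg (by simp [hfx])] with t h1 h2
    exact ⟨h1, by linarith⟩
  have hsmall : ∀ᶠ t in nhdsWithin (0 : ℝ) (Set.Ioi 0), t * (‖v‖ + ‖cross3 u v‖) < r := by
    have h1 : Filter.Tendsto (fun t : ℝ => t * (‖v‖ + ‖cross3 u v‖)) (nhds 0) (nhds 0) := by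
      exact Continuous.tendsto' (by fun_prop) 0 0 (zero_mul _)
    exact (h1.eventually (gt_mem_nhds hr)).filter_mono nhdsWithin_le_nhds
  obtain ⟨t, ⟨⟨h1, h2⟩, h3⟩, ht⟩ := ((hsign.and hsmall).and self_mem_nhdsWithin).exists
  have ht : 0 < t := ht
  set γ : ℝ → E3 := fun φ => x + t • (Real.cos φ • v + Real.sin φ • cross3 u v) with hγ
  have hγc : Continuous γ := by fun_prop
  have hγU : ∀ φ, γ φ ∈ U := by
    intro φ
    apply hball
    rw [mem_ball_iff_norm, hγ]
    simp only [add_sub_cancel_left]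
    rw [norm_smul, Real.norm_of_nonneg ht.le]
    refine lt_of_le_of_lt (mul_le_mul_of_nonneg_left ?_ ht.le) h3
    refine (norm_add_le _ _).trans (add_le_add ?_ ?_) <;> rw [norm_smul, Real.norm_eq_abs]
    · exact mul_le_of_le_one_left (norm_nonneg _) (Real.abs_cos_le_one φ)
    · exact mul_le_of_le_one_left (norm_nonneg _) (Real.abs_sin_le_one φ)
  have hcont : ContinuousOn (f ∘ γ) (Set.Icc 0 Real.pi) :=
    hf.continuousOn.comp hγc.continuousOn fun φ _ => hγU φ
  have hγ0 : γ 0 = x + t • v := by simp [hγ]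
  have hγpi : γ Real.pi = x + t • (-v) := by simp [hγ]
  obtain ⟨φ, -, hφ⟩ := intermediate_value_Icc' Real.pi_pos.le hcont
    (show (0 : ℝ) ∈ Set.Icc ((f ∘ γ) Real.pi) ((f ∘ γ) 0) by
      simp only [Function.comp_apply, hγ0, hγpi]
      exact ⟨h2.le, h1.le⟩)
  have hmem : γ φ ∈ S := (hSU.symm ▸ (⟨hγU φ, hφ⟩ : γ φ ∈ {y ∈ U | f y = 0}) : γ φ ∈ S ∩ U).1
  have h4 := hline _ hmem
  simp only [hγ, add_sub_cancel_left, cross3_smul_right, smul_eq_zero, ht.ne', false_or,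
    cross3_add_right] at h4
  have h5 := congrArg (fun w => ⟪cross3 u v, w⟫) h4
  have h6 := congrArg (fun w => ⟪cross3 u (cross3 u v), w⟫) h4
  have h7 : ⟪cross3 u (cross3 u v), cross3 u v⟫ = 0 := by
    rw [real_inner_comm, inner_cross3_self]
  simp only [inner_add_right, real_inner_smul_right, inner_cross3_self, inner_zero_right, h7,
    norm_sq_cross3_unit hu (cross3 u v), inner_self_cross3, mul_zero, zero_add, add_zero] at h5 h6
  have h8 : ⟪cross3 u v, cross3 u v⟫ ≠ 0 := fun h => huv (inner_self_eq_zero (𝕜 := ℝ).1 h)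
  have h9 : Real.cos φ = 0 := (mul_eq_zero.1 h5).resolve_right h8
  have h10 : Real.sin φ = 0 := by
    simpa [huv] using h6
  have := Real.sin_sq_add_cos_sq φ
  rw [h9, h10] at this
  norm_num at this

/-! ### Screw-invariant sets and their infinitesimal symmetries -/

/-- `S` is preserved by all the screw motions of parameter `lam` around the oriented line through
`a` directed by `u`. -/
def IsScrewInvariant (S : Set E3) (a u : E3) (lam : ℝ) : Prop :=
  ∀ x ∈ S, ∀ θ : ℝ, screwMotion a u lam θ x ∈ S

theorem IsScrewInvariant.neg {S : Set E3} {a u : E3} {lam : ℝ} (h : IsScrewInvariant S a u lam) :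
    IsScrewInvariant S a (-u) lam := by
  intro x hx θ
  have h1 := h x hx (-θ)
  rw [screwMotion_eq] at h1 ⊢
  rw [← rot_neg_axis, neg_neg] at h1
  convert h1 using 2
  module

/-- The field `x ↦ u × x + screwMoment a u lam` generates the screw motions. -/
noncomputable def screwMoment (a u : E3) (lam : ℝ) : E3 := lam • u - cross3 u a

theorem hasDerivAt_rot {u : E3} {w : ℝ → E3} {w' : E3} (hw : HasDerivAt w w' 0) :
    HasDerivAt (fun θ => rot u θ (w θ)) (w' + cross3 u (w 0)) 0 := by
  have h1 := (Real.hasDerivAt_cos 0).smul hw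
  have h2 := (Real.hasDerivAt_sin 0).smul ((crossCLM u).hasFDerivAt.comp_hasDerivAt 0 hw)
  have h3 : HasDerivAt (fun θ => ⟪u, w θ⟫) ⟪u, w'⟫ 0 :=
    (innerSL ℝ u).hasFDerivAt.comp_hasDerivAt 0 hw
  have h4 := ((((Real.hasDerivAt_cos 0).const_sub 1).mul h3).smul_const u)
  refine (((h1.add h2).add h4).congr_deriv ?_).congr_of_eventuallyEq ?_
  · simp
  · exact Filter.Eventually.of_forall fun θ => by simp [rot_apply]

theorem hasDerivAt_screwMotion (a u : E3) (lam : ℝ) (x : E3) :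
    HasDerivAt (fun θ => screwMotion a u lam θ x) (cross3 u x + screwMoment a u lam) 0 := by
  have h1 := hasDerivAt_rot (u := u) (hasDerivAt_const (0 : ℝ) (x - a))
  have h2 := (((hasDerivAt_id (0 : ℝ)).const_mul lam).smul_const u)
  refine (((h1.const_add a).add h2).congr_deriv ?_).congr_of_eventuallyEq ?_
  · rw [screwMoment, cross3_sub_right]; simp; module
  · exact Filter.Eventually.of_forall fun θ => by simp [screwMotion_eq]

theorem screwMotion_zero (a u : E3) (lam : ℝ) (x : E3) : screwMotion a u lam 0 x = x := by
  simp [screwMotion_eq, rot_zero]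

theorem screwMotion_screwMotion_neg {u : E3} (hu : ‖u‖ = 1) (a : E3) (lam θ : ℝ) (x : E3) :
    screwMotion a u lam θ (screwMotion a u lam (-θ) x) = x := by
  have : a + rot u (-θ) (x - a) + (lam * -θ) • u - a = rot u (-θ) (x - a) + (lam * -θ) • u := by
    module
  rw [screwMotion_eq, screwMotion_eq, this, map_add, map_smul, rot_self hu, rot_rot_neg hu]
  module

/-- The infinitesimal rigid motions `x ↦ w × x + m`, encoded by the pairs `(w, m)`, which are
tangent to `S` at every point of `S`. -/
def infinitesimalSymmetries (S : Set E3) : Submodule ℝ (E3 × E3) where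
  carrier := {p | ∀ x ∈ S, cross3 p.1 x + p.2 ∈ tangentVectors S x}
  add_mem' := fun {p q} hp hq x hx => by
    have := (tangentVectors S x).add_mem (hp x hx) (hq x hx)
    rw [Prod.fst_add, Prod.snd_add, cross3_add_left]
    convert this using 1
    module
  zero_mem' := fun x _ => by
    simp only [Prod.fst_zero, Prod.snd_zero, cross3_zero_left, add_zero]
    exact Submodule.zero_mem _
  smul_mem' := fun c p hp x hx => by
    have := (tangentVectors S x).smul_mem c (hp x hx)
    rw [Prod.smul_fst, Prod.smul_snd, cross3_smul_left]
    rwa [smul_add] at this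

theorem IsScrewInvariant.mem_infinitesimalSymmetries {S : Set E3} {a u : E3} {lam : ℝ}
    (h : IsScrewInvariant S a u lam) : (u, screwMoment a u lam) ∈ infinitesimalSymmetries S := by
  intro x hx
  have := velocity_mem_tangentVectors (hasDerivAt_screwMotion a u lam x) (h x hx)
  rwa [screwMotion_zero] at this

/-- The infinitesimal symmetries of a screw-invariant set are stable under the Lie bracket with the
generator of the screw motions. -/
theorem IsScrewInvariant.bracket_mem {S : Set E3} {a u : E3} {lam : ℝ} (hu : ‖u‖ = 1)
    (h : IsScrewInvariant S a u lam) {w m : E3} (hwm : (w, m) ∈ infinitesimalSymmetries S) :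
    (cross3 u w, cross3 u m - cross3 w (screwMoment a u lam)) ∈ infinitesimalSymmetries S := by
  intro x hx
  -- the field transported by the screw motion of angle `θ`, evaluated at `x`
  have hmem : ∀ θ, rot u θ (cross3 w (screwMotion a u lam (-θ) x) + m) ∈ tangentVectors S x := by
    intro θ
    have hg : HasFDerivAt (screwMotion a u lam θ) (rot u θ) (screwMotion a u lam (-θ) x) := by
      have h1 : screwMotion a u lam θ = fun y => rot u θ y + (a - rot u θ a + (lam * θ) • u) := by
        funext y
        rw [screwMotion_eq, map_sub]
        module
      rw [h1]
      exact (rot u θ).hasFDerivAt.add_const _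
    have := tangentVectors_map hg (fun y hy => h y hy θ)
      (hwm (screwMotion a u lam (-θ) x) (h x hx (-θ)))
    rwa [screwMotion_screwMotion_neg hu] at this
  have hneg : HasDerivAt (fun θ => screwMotion a u lam (-θ) x)
      (-(cross3 u x + screwMoment a u lam)) 0 := by
    have h1 : HasDerivAt (fun θ => screwMotion a u lam θ x)
      (cross3 u x + screwMoment a u lam) (-0) := by
      rw [neg_zero]; exact hasDerivAt_screwMotion a u lam x
    exact (h1.scomp (0 : ℝ) (hasDerivAt_neg (0 : ℝ))).congr_deriv (by simp [add_comm])
  have hfield : HasDerivAt (fun θ => cross3 w (screwMotion a u lam (-θ) x) + m)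
      (cross3 w (-(cross3 u x + screwMoment a u lam))) 0 :=
    (((crossCLM w).hasFDerivAt.comp_hasDerivAt (0 : ℝ) hneg)).add_const m
  have hd := deriv_mem_tangentVectors (hasDerivAt_rot hfield) hmem
  convert hd using 1
  simp only [neg_zero, screwMotion_zero]
  apply E3.ext_coord <;> simp <;> ring

/-- If two screw invariances of a surface have non-parallel axes, no translation is an
infinitesimal symmetry: brackets would produce all the translations. -/
theorem IsC1Surface.translation_eq_zero {S : Set E3} (hS : IsC1Surface S) (hne : S.Nonempty)
    {a₁ u₁ a₂ u₂ : E3} {lam₁ lam₂ : ℝ} (hu₁ : ‖u₁‖ = 1) (hu₂ : ‖u₂‖ = 1)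
    (h₁ : IsScrewInvariant S a₁ u₁ lam₁) (h₂ : IsScrewInvariant S a₂ u₂ lam₂)
    (hn : cross3 u₁ u₂ ≠ 0) {t : E3} (ht : (0, t) ∈ infinitesimalSymmetries S) : t = 0 := by
  set V : Submodule ℝ E3 := (infinitesimalSymmetries S).comap (LinearMap.inr ℝ E3 E3) with hV
  have hmem : ∀ w : E3, w ∈ V ↔ (0, w) ∈ infinitesimalSymmetries S := fun w => Iff.rfl
  have hb₁ : ∀ w ∈ V, cross3 u₁ w ∈ V := fun w hw => by
    have := h₁.bracket_mem hu₁ hw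
    simpa [hmem] using this
  have hb₂ : ∀ w ∈ V, cross3 u₂ w ∈ V := fun w hw => by
    have := h₂.bracket_mem hu₂ hw
    simpa [hmem] using this
  have hVtop : V ≠ ⊤ := by
    intro htop
    obtain ⟨x, hx⟩ := hne
    apply hS.tangentVectors_ne_top hx
    rw [eq_top_iff]
    intro v _
    have hv : v ∈ V := htop ▸ Submodule.mem_top
    simpa using hv x hx
  have hi₁ := inner_self_of_norm_one hu₁
  have hi₂ := inner_self_of_norm_one hu₂
  set n := cross3 u₁ u₂ with hnn
  have hn0 : ⟪n, n⟫ ≠ 0 := fun h => hn (inner_self_eq_zero (𝕜 := ℝ).1 h)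
  have hnv : ⟪n, n⟫ = 1 - ⟪u₁, u₂⟫ ^ 2 := by
    rw [hnn, norm_sq_cross3_unit hu₁, hi₂]
  have hnV : n ∉ V := by
    intro hnV
    have e1 : ⟪u₁, u₂⟫ • u₁ - u₂ ∈ V := by
      have := hb₁ n hnV
      rwa [hnn, cross3_cross3, hi₁, one_smul] at this
    have e2 : u₁ - ⟪u₁, u₂⟫ • u₂ ∈ V := by
      have := hb₂ n hnV
      rwa [hnn, cross3_cross3, hi₂, one_smul, real_inner_comm] at this
    have f1 : ⟪n, n⟫ • u₁ ∈ V := by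
      have := V.sub_mem e2 (V.smul_mem ⟪u₁, u₂⟫ e1)
      convert this using 1
      rw [hnv]; module
    have f2 : ⟪n, n⟫ • u₂ ∈ V := by
      have := V.sub_mem (V.smul_mem ⟪u₁, u₂⟫ e2) e1
      convert this using 1
      rw [hnv]; module
    rw [V.smul_mem_iff hn0] at f1 f2
    apply hVtop
    rw [eq_top_iff]
    intro v _
    -- expansion of `v` in the basis formed by `u₁`, `u₂` and their product
    have hexp : ⟪n, n⟫ • v = ⟪v, cross3 u₂ n⟫ • u₁ + ⟪v, cross3 n u₁⟫ • u₂ + ⟪v, n⟫ • n := by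
      rw [hnn]
      apply E3.ext_coord <;>
        simp only [inner_coord, PiLp.add_apply, PiLp.smul_apply, smul_eq_mul, cross3_zero_coord,
          cross3_one_coord, cross3_two_coord] <;> ring
    rw [← V.smul_mem_iff hn0, hexp]
    exact V.add_mem (V.add_mem (V.smul_mem _ f1) (V.smul_mem _ f2)) (V.smul_mem _ hnV)
  -- if `u × w ≠ 0`, then `u × w` and `u × (u × w)` span the plane orthogonal to `u`, which
  -- contains `n`
  have hcross : ∀ u w : E3, ‖u‖ = 1 → (∀ w ∈ V, cross3 u w ∈ V) → w ∈ V → ⟪u, n⟫ = 0 →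
      cross3 u w = 0 := by
    intro u w hu hb hw hun
    by_contra h0
    set p := cross3 u w with hp
    have hp0 : ⟪p, p⟫ ≠ 0 := fun h => h0 (inner_self_eq_zero (𝕜 := ℝ).1 h)
    have hup : ⟪u, p⟫ = 0 := inner_self_cross3 u w
    have hnp : ⟪p, p⟫ • n = ⟪p, n⟫ • p + ⟪cross3 u p, n⟫ • cross3 u p := by
      have hpn : cross3 p n = ⟪u, cross3 p n⟫ • u :=
        eq_smul_of_cross3_eq_zero hu (by rw [cross3_cross3, hup, hun]; simp)
      have h3 := cross3_cross3 p p n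
      rw [hpn, cross3_smul_right, inner_cross3_rotate, inner_cross3_rotate,
        real_inner_comm, cross3_swap p u] at h3
      linear_combination (norm := module) h3
    apply hnV
    rw [← V.smul_mem_iff hp0, hnp]
    have hpV := hb w hw
    exact V.add_mem (V.smul_mem _ hpV) (V.smul_mem _ (hb _ hpV))
  have c1 := hcross u₁ t hu₁ hb₁ ht (inner_self_cross3 _ _)
  have c2 := hcross u₂ t hu₂ hb₂ ht (inner_cross3_self _ _)
  have d1 := eq_smul_of_cross3_eq_zero hu₁ c1
  rw [d1, cross3_smul_right, cross3_swap, smul_neg, neg_eq_zero, smul_eq_zero] at c2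
  rw [d1, c2.resolve_right hn, zero_smul]

/-- For two screw invariances of a surface with non-parallel axes, the first one is a rotation and
the Klein product of the two generators vanishes. -/
theorem IsC1Surface.lam_eq_zero_of_cross3_ne_zero {S : Set E3} (hS : IsC1Surface S)
    (hne : S.Nonempty) {a₁ u₁ a₂ u₂ : E3} {lam₁ lam₂ : ℝ} (hu₁ : ‖u₁‖ = 1) (hu₂ : ‖u₂‖ = 1)
    (h₁ : IsScrewInvariant S a₁ u₁ lam₁) (h₂ : IsScrewInvariant S a₂ u₂ lam₂)
    (hn : cross3 u₁ u₂ ≠ 0) : lam₁ = 0 ∧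
      ⟪u₂, screwMoment a₁ u₁ lam₁⟫ + ⟪u₁, screwMoment a₂ u₂ lam₂⟫ = 0 := by
  set m₁ := screwMoment a₁ u₁ lam₁ with hm₁
  set m₂ := screwMoment a₂ u₂ lam₂ with hm₂
  set n := cross3 u₁ u₂ with hnn
  have hi₁ := inner_self_of_norm_one hu₁
  have hi₂ := inner_self_of_norm_one hu₂
  have p1 := h₁.mem_infinitesimalSymmetries
  have p2 := h₂.mem_infinitesimalSymmetries
  have p3 := h₁.bracket_mem hu₁ p2
  have p4 := h₁.bracket_mem hu₁ p3
  rw [← hm₁, ← hm₂] at p3 p4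
  -- `[ξ₁, [ξ₁, ξ₂]] - ⟨u₁, u₂⟩ ξ₁ + ξ₂` is a translation, hence zero
  have p5 := (infinitesimalSymmetries S).add_mem
    ((infinitesimalSymmetries S).sub_mem p4 ((infinitesimalSymmetries S).smul_mem ⟪u₁, u₂⟫ p1)) p2
  simp only [Prod.smul_mk, Prod.mk_sub_mk, Prod.mk_add_mk] at p5
  have hz : cross3 u₁ (cross3 u₁ u₂) - ⟪u₁, u₂⟫ • u₁ + u₂ = 0 := by
    rw [cross3_cross3, hi₁]; module
  rw [hz] at p5
  have ht := hS.translation_eq_zero hne hu₁ hu₂ h₁ h₂ hn p5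
  rw [← hm₁, ← hm₂] at ht
  have hl1 : ⟪u₁, m₁⟫ = lam₁ := by
    simp [hm₁, screwMoment, inner_sub_right, real_inner_smul_right, hu₁]
  have hl2 : ⟪u₂, m₂⟫ = lam₂ := by
    simp [hm₂, screwMoment, inner_sub_right, real_inner_smul_right, hu₂]
  have e1 := congrArg (fun w => ⟪u₁, w⟫) ht
  have e2 := congrArg (fun w => ⟪u₂, w⟫) ht
  simp only [cross3_sub_right, cross3_cross3, cross3_cross3_left, inner_add_right, inner_sub_right,
    real_inner_smul_right, hi₁, hi₂, hl1, hl2, real_inner_comm u₁ u₂, inner_zero_right] at e1 e2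
  have hn0 : ⟪n, n⟫ ≠ 0 := fun h => hn (inner_self_eq_zero (𝕜 := ℝ).1 h)
  have hnv : ⟪n, n⟫ = 1 - ⟪u₁, u₂⟫ ^ 2 := by
    rw [hnn, norm_sq_cross3_unit hu₁, hi₂]
  have hlam : lam₁ = 0 := by
    have : ⟪n, n⟫ * lam₁ = 0 := by
      rw [hnv]
      linear_combination (⟪u₁, u₂⟫ * e1 - e2) / 2
    exact (mul_eq_zero.1 this).resolve_left hn0
  refine ⟨hlam, ?_⟩
  linear_combination e1 + 2 * ⟪u₁, u₂⟫ * hlam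

/-! ### Parallel axes -/

theorem IsScrewInvariant.shift_base {S : Set E3} {a u : E3} {lam : ℝ} (hu : ‖u‖ = 1)
    (h : IsScrewInvariant S a u lam) (t : ℝ) : IsScrewInvariant S (a + t • u) u lam := by
  intro x hx θ
  convert h x hx θ using 1
  rw [screwMotion_eq, screwMotion_eq, ← sub_sub, map_sub, map_smul, rot_self hu]
  module

/-- Composing a screw motion with the inverse of another one with a parallel axis and the same angle
gives a translation. -/
theorem IsScrewInvariant.add_mem_of_parallel {S : Set E3} {a₁ a₂ u : E3} {lam₁ lam₂ : ℝ}
    (hu : ‖u‖ = 1) (h₁ : IsScrewInvariant S a₁ u lam₁) (h₂ : IsScrewInvariant S a₂ u lam₂) {x : E3}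
    (hx : x ∈ S) (θ : ℝ) :
    x + ((a₁ - a₂) - rot u θ (a₁ - a₂) + ((lam₁ - lam₂) * θ) • u) ∈ S := by
  convert h₁ _ (h₂ x hx (-θ)) θ using 1
  have : a₂ + rot u (-θ) (x - a₂) + (lam₂ * -θ) • u - a₁
      = rot u (-θ) (x - a₂) - (a₁ - a₂) + (lam₂ * -θ) • u := by module
  rw [screwMotion_eq, screwMotion_eq, this, map_add, map_sub _ _ (a₁ - a₂),
    rot_rot_neg hu, map_smul, rot_self hu]
  module

/-- The vectors of the translations mapping `S` into itself. -/
def translationVectors (S : Set E3) : AddSubmonoid E3 where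
  carrier := {v | ∀ x ∈ S, x + v ∈ S}
  add_mem' := fun hv hw x hx => by rw [← add_assoc]; exact hw _ (hv x hx)
  zero_mem' := fun x hx => by rwa [add_zero]

theorem IsScrewInvariant.rot_mem_translationVectors {S : Set E3} {a u : E3} {lam : ℝ}
    (hu : ‖u‖ = 1) (h : IsScrewInvariant S a u lam) {v : E3} (hv : v ∈ translationVectors S)
    (θ : ℝ) : rot u θ v ∈ translationVectors S := by
  intro x hx
  convert h _ (hv _ (h x hx (-θ))) θ using 1
  have : a + rot u (-θ) (x - a) + (lam * -θ) • u + v - a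
      = rot u (-θ) (x - a) + (lam * -θ) • u + v := by module
  rw [screwMotion_eq, screwMotion_eq, this, map_add, map_add, rot_rot_neg hu, map_smul, rot_self hu]
  module

/-- A set with two screw invariances of distinct parallel axes is invariant under all the
translations orthogonal to the axes. -/
theorem mem_translationVectors_of_parallel {S : Set E3} {a₁ a₂ u : E3} {lam₁ lam₂ : ℝ}
    (hu : ‖u‖ = 1) (h₁ : IsScrewInvariant S a₁ u lam₁) (h₂ : IsScrewInvariant S a₂ u lam₂)
    (hd : cross3 u (a₁ - a₂) ≠ 0) {w : E3} (hw : ⟪u, w⟫ = 0) : w ∈ translationVectors S := by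
  set d := a₁ - a₂ with hdd
  set D := ⟪d, d⟫ - ⟪u, d⟫ ^ 2 with hD
  have hDpos : 0 < D := by
    rw [hD, ← norm_sq_cross3_unit hu]
    exact real_inner_self_pos.2 hd
  have hq : ∀ θ, ⟪u, d - rot u θ d⟫ = 0 := fun θ => by rw [inner_sub_right, inner_rot hu, sub_self]
  -- conjugating by a half-turn and subtracting eliminates the component along the axis
  have hT : ∀ θ, (-2 : ℝ) • (d - rot u θ d) ∈ translationVectors S := by
    intro θ
    have e1 : d - rot u θ d + ((lam₁ - lam₂) * θ) • u ∈ translationVectors S :=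
      fun x hx => h₁.add_mem_of_parallel hu h₂ hx θ
    have e2 : -(d - rot u θ d + ((lam₁ - lam₂) * θ) • u) ∈ translationVectors S := by
      intro x hx
      convert h₂.add_mem_of_parallel hu h₁ hx θ using 2
      rw [← neg_sub a₁ a₂, ← hdd, map_neg]
      module
    have e3 := (translationVectors S).add_mem (h₁.rot_mem_translationVectors hu e1 Real.pi) e2
    have e4 : rot u Real.pi (d - rot u θ d) = -(d - rot u θ d) := by
      rw [rot_apply, hq]; simp
    rw [map_add, map_smul, rot_self hu, e4] at e3
    convert e3 using 1
    module
  have hnorm : ∀ θ, ⟪(-2 : ℝ) • (d - rot u θ d), (-2 : ℝ) • (d - rot u θ d)⟫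
      = 8 * D * (1 - Real.cos θ) := by
    intro θ
    simp only [real_inner_smul_left, real_inner_smul_right, inner_sub_left, inner_sub_right,
      norm_sq_rot hu, inner_self_rot, real_inner_comm d (rot u θ d)]
    rw [hD]; ring
  -- the short vectors are obtained by rotating these ones, and the others are multiples of them
  have hshort : ∀ w : E3, ⟪u, w⟫ = 0 → ⟪w, w⟫ ≤ 16 * D → w ∈ translationVectors S := by
    intro w hw hle
    have hcos : Real.cos (Real.arccos (1 - ⟪w, w⟫ / (8 * D))) = 1 - ⟪w, w⟫ / (8 * D) := by
      have h1 : 0 ≤ ⟪w, w⟫ / (8 * D) := div_nonneg real_inner_self_nonneg (by linarith)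
      have h2 : ⟪w, w⟫ / (8 * D) ≤ 2 := by
        rw [div_le_iff₀ (by linarith)]; linarith
      exact Real.cos_arccos (by linarith) (by linarith)
    obtain ⟨φ, hφ⟩ := exists_rot_eq (v := (-2 : ℝ) • (d - rot u (Real.arccos
      (1 - ⟪w, w⟫ / (8 * D))) d)) (w := w) hu
      (by rw [hnorm, hcos]; field_simp; ring) (by rw [real_inner_smul_right, hq, hw, mul_zero])
    rw [← hφ]
    exact h₁.rot_mem_translationVectors hu (hT _) φ
  obtain ⟨n, hn⟩ := exists_nat_ge (⟪w, w⟫ / (16 * D))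
  have hn1 : (0 : ℝ) < (n : ℝ) + 1 := by positivity
  have h := (translationVectors S).nsmul_mem (hshort (((n : ℝ) + 1)⁻¹ • w)
    (by rw [real_inner_smul_right, hw, mul_zero]) (by
      rw [real_inner_smul_left, real_inner_smul_right, ← mul_assoc, ← mul_inv, inv_mul_le_iff₀
        (by positivity)]
      rw [div_le_iff₀ (by linarith)] at hn
      have : (n : ℝ) ≤ ((n : ℝ) + 1) * ((n : ℝ) + 1) := by nlinarith
      nlinarith)) (n + 1)
  rw [← Nat.cast_smul_eq_nsmul ℝ, Nat.cast_add_one, smul_smul, mul_inv_cancel₀ hn1.ne',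
    one_smul] at h
  exact h

theorem IsC1Surface.isAffinePlane {S : Set E3} (hS : IsC1Surface S) (hconn : IsConnected S)
    {u : E3} (hu : ‖u‖ = 1) (ht : ∀ w : E3, ⟪u, w⟫ = 0 → w ∈ translationVectors S) :
    IsAffinePlane S := by
  obtain ⟨x, hx⟩ := hconn.nonempty
  have hlev := hS.eq_level_set hconn (h := fun y => ⟪u, y⟫) (by fun_prop)
    (fun y hy z hz => by
      have := ht (z - y) (by rw [inner_sub_right, hz, sub_self]) y hy
      rwa [add_sub_cancel] at this) hx
  refine ⟨AffineSubspace.mk' x (Submodule.span ℝ {u})ᗮ, ?_, ?_⟩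
  · rw [AffineSubspace.direction_mk']
    have : Fact (Module.finrank ℝ E3 = 2 + 1) := ⟨finrank_euclideanSpace_fin⟩
    exact Submodule.finrank_orthogonal_span_singleton (norm_ne_zero_iff.1 (by rw [hu]; simp))
  · ext y
    rw [hlev, SetLike.mem_coe, AffineSubspace.mem_mk', vsub_eq_sub,
      Submodule.mem_orthogonal_singleton_iff_inner_right, inner_sub_right, sub_eq_zero]
    rfl

/-- The orbits of the rotations and translations along an axis are the level sets of the distance
to this axis. -/
theorem exists_rot_add_eq {a u x y : E3} (hu : ‖u‖ = 1)
    (h : ⟪cross3 u (y - a), cross3 u (y - a)⟫ = ⟪cross3 u (x - a), cross3 u (x - a)⟫) :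
    ∃ θ s : ℝ, axisRotation a u θ (x + s • u) = y := by
  rw [norm_sq_cross3_unit hu, norm_sq_cross3_unit hu] at h
  have hi := inner_self_of_norm_one hu
  have e : x + (⟪u, y - a⟫ - ⟪u, x - a⟫) • u - a
      = (x - a) + (⟪u, y - a⟫ - ⟪u, x - a⟫) • u := by module
  obtain ⟨θ, hθ⟩ := exists_rot_eq (v := x + (⟪u, y - a⟫ - ⟪u, x - a⟫) • u - a) (w := y - a) hu
    (by
      rw [e]
      simp only [inner_add_left, inner_add_right, real_inner_smul_left, real_inner_smul_right, hi,
        real_inner_comm u (x - a)]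
      linear_combination -h)
    (by rw [e, inner_add_right, real_inner_smul_right, hi]; ring)
  exact ⟨θ, _, by rw [axisRotation_eq, hθ, add_sub_cancel]⟩

theorem mem_lineThrough {a u y : E3} : y ∈ lineThrough a u ↔ ∃ s : ℝ, y = a + s • u := by
  rw [lineThrough, AffineSubspace.mem_mk', vsub_eq_sub, Submodule.mem_span_singleton]
  exact exists_congr fun s => by rw [eq_sub_iff_add_eq', eq_comm]

theorem IsC1Surface.isCylinderOfRevolution {S : Set E3} (hS : IsC1Surface S)
    (hconn : IsConnected S) {a u : E3} (hu : ‖u‖ = 1)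
    (hrot : ∀ x ∈ S, ∀ θ, axisRotation a u θ x ∈ S) (ht : ∀ x ∈ S, ∀ s : ℝ, x + s • u ∈ S) :
    IsCylinderOfRevolution S := by
  obtain ⟨b, hb⟩ := hconn.nonempty
  have hlev := hS.eq_level_set hconn (h := fun y => ⟪cross3 u (y - a), cross3 u (y - a)⟫)
    (by
      have : Continuous fun y : E3 => cross3 u (y - a) :=
        (continuous_cross3 u).comp (continuous_id.sub continuous_const)
      exact this.inner this)
    (fun x hx y hy => by
      obtain ⟨θ, s, rfl⟩ := exists_rot_add_eq hu hy
      exact hrot _ (ht x hx s) θ) hb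
  refine ⟨a, u, b, hu, ?_, ?_⟩
  · intro hba
    obtain ⟨s, hs⟩ := mem_lineThrough.1 hba
    obtain ⟨y, hy, hyb⟩ := hS.exists_not_mem_line hb hu
    have hb0 : cross3 u (b - a) = 0 := by
      rw [hs, add_sub_cancel_left, cross3_smul_right, cross3_self, smul_zero]
    rw [hlev, Set.mem_ofPred_eq, hb0, inner_zero_left, inner_self_eq_zero] at hy
    apply hyb
    rw [← sub_sub_sub_cancel_right y b a, cross3_sub_right, hy, hb0, sub_zero]
  · apply Set.Subset.antisymm
    · intro y hy
      rw [hlev] at hy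
      obtain ⟨θ, s, hθ⟩ := exists_rot_add_eq hu hy
      exact Set.mem_iUnion.2 ⟨θ, b + s • u, mem_lineThrough.2 ⟨s, rfl⟩, hθ⟩
    · intro y hy
      obtain ⟨θ, z, hz, rfl⟩ := Set.mem_iUnion.1 hy
      obtain ⟨s, rfl⟩ := mem_lineThrough.1 hz
      exact hrot _ (ht b hb s) θ

/-! ### Intersecting axes -/

/-- Existence of a vector of given length and given components along two unit vectors. -/
theorem exists_inner_eq {u₁ u₂ : E3} (hu₁ : ‖u₁‖ = 1) (hu₂ : ‖u₂‖ = 1) (hn : cross3 u₁ u₂ ≠ 0)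
    {s t r : ℝ} (h : s ^ 2 + t ^ 2 - 2 * ⟪u₁, u₂⟫ * s * t ≤ r * (1 - ⟪u₁, u₂⟫ ^ 2)) :
    ∃ z : E3, ⟪z, z⟫ = r ∧ ⟪u₁, z⟫ = s ∧ ⟪u₂, z⟫ = t := by
  have hi₁ := inner_self_of_norm_one hu₁
  have hi₂ := inner_self_of_norm_one hu₂
  set n := cross3 u₁ u₂ with hnn
  set c := ⟪u₁, u₂⟫ with hc
  have hnv : ⟪n, n⟫ = 1 - c ^ 2 := by rw [hnn, norm_sq_cross3_unit hu₁, hi₂]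
  have hpos : 0 < 1 - c ^ 2 := hnv ▸ real_inner_self_pos.2 hn
  have hn1 : ⟪u₁, n⟫ = 0 := inner_self_cross3 _ _
  have hn2 : ⟪u₂, n⟫ = 0 := inner_cross3_self _ _
  set g := (r - (s ^ 2 + t ^ 2 - 2 * c * s * t) / (1 - c ^ 2)) / (1 - c ^ 2) with hg
  have hg0 : 0 ≤ g := by
    apply div_nonneg _ hpos.le
    rw [sub_nonneg, div_le_iff₀ hpos]
    exact h
  have hsq := Real.mul_self_sqrt hg0
  refine ⟨((s - c * t) / (1 - c ^ 2)) • u₁ + ((t - c * s) / (1 - c ^ 2)) • u₂ + √g • n, ?_, ?_, ?_⟩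
  · simp only [inner_add_left, inner_add_right, real_inner_smul_left, real_inner_smul_right, hi₁,
      hi₂, ← hc, real_inner_comm u₁ u₂, real_inner_comm u₁ n, real_inner_comm u₂ n, hn1, hn2, hnv]
    have : √g * (√g * (1 - c ^ 2)) = r - (s ^ 2 + t ^ 2 - 2 * c * s * t) / (1 - c ^ 2) := by
      rw [← mul_assoc, hsq, hg, div_mul_cancel₀ _ hpos.ne']
    simp only [mul_zero, add_zero, zero_add, this]
    field_simp
    ring
  · simp only [inner_add_right, real_inner_smul_right, hi₁, ← hc, hn1]
    field_simp
    ring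
  · simp only [inner_add_right, real_inner_smul_right, hi₂, real_inner_comm u₁ u₂, ← hc, hn2]
    field_simp
    ring

/-- The rotations around two non-parallel directions act transitively on spheres. In terms of the
components `(s, t)` along the two directions, whose scalar product is `c`, one can move from
`(s, t)` to `(s, c s)`, then to `(c ^ 2 s, c s)`; iterating makes `s` so small that `(s, 0)` and then
`(0, 0)` can be reached. -/
theorem sphere_transitive {u₁ u₂ : E3} (hu₁ : ‖u₁‖ = 1) (hu₂ : ‖u₂‖ = 1) (hn : cross3 u₁ u₂ ≠ 0)
    {P : E3 → Prop} (h₁ : ∀ v w : E3, ⟪v, v⟫ = ⟪w, w⟫ → ⟪u₁, v⟫ = ⟪u₁, w⟫ → P v → P w)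
    (h₂ : ∀ v w : E3, ⟪v, v⟫ = ⟪w, w⟫ → ⟪u₂, v⟫ = ⟪u₂, w⟫ → P v → P w) {x y : E3}
    (hxy : ⟪x, x⟫ = ⟪y, y⟫) (hx : P x) : P y := by
  have h₁' : ∀ v w : E3, ⟪v, v⟫ = ⟪w, w⟫ → ⟪u₁, v⟫ = ⟪u₁, w⟫ → (P v ↔ P w) := fun v w h h' =>
    ⟨h₁ v w h h', h₁ w v h.symm h'.symm⟩
  have h₂' : ∀ v w : E3, ⟪v, v⟫ = ⟪w, w⟫ → ⟪u₂, v⟫ = ⟪u₂, w⟫ → (P v ↔ P w) := fun v w h h' =>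
    ⟨h₂ v w h h', h₂ w v h.symm h'.symm⟩
  set c := ⟪u₁, u₂⟫ with hc
  have hpos : 0 < 1 - c ^ 2 := by
    rw [← inner_self_of_norm_one hu₂, hc, ← norm_sq_cross3_unit hu₁]
    exact real_inner_self_pos.2 hn
  have hcs : ∀ v : E3, ⟪u₁, v⟫ ^ 2 ≤ ⟪v, v⟫ := fun v => by
    have := norm_sq_cross3_unit hu₁ v
    have h0 : 0 ≤ ⟪cross3 u₁ v, cross3 u₁ v⟫ := real_inner_self_nonneg
    linarith
  have hstep : ∀ v : E3, ∃ w : E3, ⟪w, w⟫ = ⟪v, v⟫ ∧ ⟪u₁, w⟫ = c ^ 2 * ⟪u₁, v⟫ ∧ (P v ↔ P w) := by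
    intro v
    have hv := mul_le_mul_of_nonneg_right (hcs v) hpos.le
    obtain ⟨z, hz, hz1, hz2⟩ := exists_inner_eq hu₁ hu₂ hn (s := ⟪u₁, v⟫) (t := c * ⟪u₁, v⟫)
      (r := ⟪v, v⟫) (by rw [← hc]; linarith)
    have hz' := mul_le_mul_of_nonneg_left hv (sq_nonneg c)
    obtain ⟨w, hw, hw1, hw2⟩ := exists_inner_eq hu₁ hu₂ hn (s := c ^ 2 * ⟪u₁, v⟫)
      (t := c * ⟪u₁, v⟫) (r := ⟪v, v⟫) (by
        rw [← hc]
        nlinarith [mul_nonneg (real_inner_self_nonneg (x := v)) (mul_self_nonneg (1 - c ^ 2))])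
    exact ⟨w, hw, hw1, (h₁' v z hz.symm hz1.symm).trans (h₂' z w (hz.trans hw.symm)
      (hz2.trans hw2.symm))⟩
  have hiter : ∀ (k : ℕ) (v : E3), ∃ w : E3, ⟪w, w⟫ = ⟪v, v⟫ ∧ ⟪u₁, w⟫ = (c ^ 2) ^ k * ⟪u₁, v⟫ ∧
      (P v ↔ P w) := by
    intro k v
    induction k with
    | zero => exact ⟨v, rfl, by simp, Iff.rfl⟩
    | succ k ih =>
      obtain ⟨w, hw, hw1, hw2⟩ := ih
      obtain ⟨z, hz, hz1, hz2⟩ := hstep w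
      exact ⟨z, hz.trans hw, by rw [hz1, hw1]; ring, hw2.trans hz2⟩
  -- every non-zero vector can be moved to a vector orthogonal to `u₁`
  have hpole : ∀ v : E3, 0 < ⟪v, v⟫ → ∃ w : E3, ⟪w, w⟫ = ⟪v, v⟫ ∧ ⟪u₁, w⟫ = 0 ∧ (P v ↔ P w) := by
    intro v hv
    obtain ⟨k, hk⟩ := exists_pow_lt_of_lt_one hpos (by linarith : c ^ 2 < 1)
    obtain ⟨w, hw, hw1, hw2⟩ := hiter k v
    have hk0 : 0 ≤ (c ^ 2) ^ k := by positivity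
    have hk1 : (c ^ 2) ^ k ≤ 1 := pow_le_one₀ (sq_nonneg c) (by linarith)
    obtain ⟨z, hz, hz1, hz2⟩ := exists_inner_eq hu₁ hu₂ hn (s := ⟪u₁, w⟫) (t := 0) (r := ⟪v, v⟫) (by
      have e1 : ((c ^ 2) ^ k) ^ 2 ≤ 1 - c ^ 2 := by nlinarith
      have e2 := mul_le_mul e1 (hcs v) (sq_nonneg _) hpos.le
      rw [← hc, hw1]
      linarith)
    obtain ⟨p, hp, hp1, hp2⟩ := exists_inner_eq hu₁ hu₂ hn (s := 0) (t := 0) (r := ⟪v, v⟫) (by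
      rw [← hc]
      have := mul_pos hv hpos
      linarith)
    exact ⟨p, hp, hp1, hw2.trans ((h₁' w z (hw.trans hz.symm) hz1.symm).trans
      (h₂' z p (hz.trans hp.symm) (hz2.trans hp2.symm)))⟩
  rcases (real_inner_self_nonneg (x := x)).eq_or_lt with h0 | h0
  · have e1 : x = 0 := inner_self_eq_zero (𝕜 := ℝ).1 h0.symm
    have e2 : y = 0 := inner_self_eq_zero (𝕜 := ℝ).1 (hxy ▸ h0.symm)
    rwa [e2, ← e1]
  · obtain ⟨p, hp, hp1, hp2⟩ := hpole x h0
    obtain ⟨q, hq, hq1, hq2⟩ := hpole y (hxy ▸ h0)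
    exact hq2.2 (h₁ p q (by rw [hp, hq, hxy]) (by rw [hp1, hq1]) (hp2.1 hx))

/-- Two coplanar lines that are not parallel meet. -/
theorem exists_common_point {a₁ u₁ a₂ u₂ : E3} (hu₁ : ‖u₁‖ = 1) (hu₂ : ‖u₂‖ = 1)
    (hn : cross3 u₁ u₂ ≠ 0) (h : ⟪cross3 u₁ u₂, a₂ - a₁⟫ = 0) :
    ∃ s t : ℝ, a₁ + s • u₁ = a₂ + t • u₂ := by
  set d := a₂ - a₁ with hd
  set n := cross3 u₁ u₂ with hnn
  have hn0 : ⟪n, n⟫ ≠ 0 := (real_inner_self_pos.2 hn).ne'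
  have e := cross3_cross3 n n d
  rw [h, hnn, cross3_cross3_left u₁ u₂ d, cross3_sub_right, cross3_smul_right, cross3_smul_right,
    cross3_cross3_left, cross3_cross3_left, inner_self_of_norm_one hu₁, inner_self_of_norm_one hu₂,
    ← hnn, real_inner_comm u₁ u₂] at e
  refine ⟨(⟪u₁, d⟫ - ⟪u₁, u₂⟫ * ⟪u₂, d⟫) / ⟪n, n⟫, -((⟪u₂, d⟫ - ⟪u₁, u₂⟫ * ⟪u₁, d⟫) / ⟪n, n⟫),
    smul_right_injective E3 hn0 ?_⟩
  have ha : a₂ = a₁ + d := by rw [hd, add_sub_cancel]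
  simp only [ha, smul_add, smul_smul, mul_neg, mul_div_cancel₀ _ hn0]
  linear_combination (norm := module) -e

theorem IsC1Surface.isRoundSphere {S : Set E3} (hS : IsC1Surface S) (hconn : IsConnected S)
    {c u₁ u₂ : E3} (hu₁ : ‖u₁‖ = 1) (hu₂ : ‖u₂‖ = 1) (hn : cross3 u₁ u₂ ≠ 0)
    (h₁ : IsScrewInvariant S c u₁ 0) (h₂ : IsScrewInvariant S c u₂ 0) : IsRoundSphere S := by
  have hP : ∀ u : E3, ‖u‖ = 1 → IsScrewInvariant S c u 0 →
      ∀ v w : E3, ⟪v, v⟫ = ⟪w, w⟫ → ⟪u, v⟫ = ⟪u, w⟫ → c + v ∈ S → c + w ∈ S := by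
    intro u hu h v w hvw huv hv
    obtain ⟨θ, rfl⟩ := exists_rot_eq hu hvw huv
    simpa [screwMotion_eq] using h _ hv θ
  obtain ⟨x, hx⟩ := hconn.nonempty
  have hlev := hS.eq_level_set hconn (h := fun y => ‖y - c‖) (by fun_prop)
    (fun y hy z hz => by
      have := sphere_transitive hu₁ hu₂ hn (P := fun v => c + v ∈ S) (hP u₁ hu₁ h₁) (hP u₂ hu₂ h₂)
        (x := y - c) (y := z - c)
        (by simp only [real_inner_self_eq_norm_sq]; rw [hz]) (by rwa [add_sub_cancel])
      rwa [add_sub_cancel] at this) hx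
  refine ⟨c, ‖x - c‖, ?_, ?_⟩
  · refine (norm_nonneg _).lt_of_ne' fun h0 => ?_
    obtain ⟨y, hy, hyx⟩ := hS.exists_not_mem_line hx hu₁
    rw [hlev, Set.mem_ofPred_eq, h0, norm_eq_zero, sub_eq_zero] at hy
    rw [norm_eq_zero, sub_eq_zero] at h0
    rw [hy, h0, sub_self, cross3_zero_right] at hyx
    exact hyx rfl
  · rw [hlev]
    ext y
    rw [mem_sphere_iff_norm, Set.mem_ofPred_eq]

/-! ### The classification -/

theorem lineThrough_neg (a u : E3) : lineThrough a (-u) = lineThrough a u := by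
  rw [lineThrough, lineThrough, ← Set.neg_singleton, Submodule.span_neg]

theorem lineThrough_add_smul (a u : E3) (t : ℝ) : lineThrough (a + t • u) u = lineThrough a u := by
  ext y
  rw [mem_lineThrough, mem_lineThrough]
  constructor
  · rintro ⟨s, rfl⟩
    exact ⟨t + s, by module⟩
  · rintro ⟨s, rfl⟩
    exact ⟨s - t, by module⟩

theorem mainTheorem6 (S : Set E3) (hS : IsC1Surface S) (hconn : IsConnected S)
    (hplane : ¬ IsAffinePlane S) (Δ₁ Δ₂ : AffineSubspace ℝ E3) (s₁ s₂ : ℝ)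
    (h₁ : HasHelicalSymmetry S Δ₁ s₁) (h₂ : HasHelicalSymmetry S Δ₂ s₂)
    (hne : Δ₁ ≠ Δ₂ ∨ s₁ ≠ s₂) :
    IsCylinderOfRevolution S ∨ IsRoundSphere S := by
  obtain ⟨a₁, u, lam₁, hu, rfl, rfl, h₁⟩ := h₁
  obtain ⟨a₂, u₂, lam₂, hu₂, rfl, rfl, h₂⟩ := h₂
  have h₁ : IsScrewInvariant S a₁ u lam₁ := h₁
  have h₂ : IsScrewInvariant S a₂ u₂ lam₂ := h₂
  by_cases hn : cross3 u u₂ = 0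
  · left
    -- orient both axes in the same way
    obtain ⟨h₂', hline⟩ : IsScrewInvariant S a₂ u lam₂ ∧ lineThrough a₂ u₂ = lineThrough a₂ u := by
      have h := eq_smul_of_cross3_eq_zero hu hn
      have h' : |⟪u, u₂⟫| = 1 := by
        have := congrArg norm h
        rwa [norm_smul, hu, hu₂, mul_one, Real.norm_eq_abs, eq_comm] at this
      rcases eq_or_eq_neg_of_abs_eq h' with h' | h' <;> rw [h'] at h
      · rw [one_smul] at h
        exact ⟨h ▸ h₂, by rw [h]⟩
      · rw [neg_one_smul] at h
        subst h
        exact ⟨by simpa using h₂.neg, lineThrough_neg _ _⟩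
    rw [hline] at hne
    by_cases hd : cross3 u (a₁ - a₂) = 0
    · have ha := eq_smul_of_cross3_eq_zero hu hd
      rw [sub_eq_iff_eq_add'] at ha
      have hlam : lam₁ - lam₂ ≠ 0 := by
        intro h0
        rw [ha, lineThrough_add_smul, sub_eq_zero.1 h0] at hne
        simp at hne
      have ht : ∀ x ∈ S, ∀ s : ℝ, x + s • u ∈ S := by
        intro x hx s
        have h := h₁.add_mem_of_parallel hu h₂' hx (s / (lam₁ - lam₂))
        rwa [eq_smul_of_cross3_eq_zero hu hd, map_smul, rot_self hu, sub_self, zero_add,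
          mul_div_cancel₀ _ hlam] at h
      refine hS.isCylinderOfRevolution hconn hu (a := a₁) (fun x hx θ => ?_) ht
      have h := ht _ (h₁ x hx θ) (-(lam₁ * θ))
      rwa [screwMotion, neg_smul, add_neg_cancel_right] at h
    · exact absurd (hS.isAffinePlane hconn hu fun w hw =>
        mem_translationVectors_of_parallel hu h₁ h₂' hd hw) hplane
  · right
    have hn' : cross3 u₂ u ≠ 0 := by rwa [cross3_swap, neg_ne_zero]
    obtain ⟨rfl, hk⟩ := hS.lam_eq_zero_of_cross3_ne_zero hconn.nonempty hu hu₂ h₁ h₂ hn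
    obtain ⟨rfl, -⟩ := hS.lam_eq_zero_of_cross3_ne_zero hconn.nonempty hu₂ hu h₂ h₁ hn'
    obtain ⟨s, t, hst⟩ := exists_common_point (a₁ := a₁) (a₂ := a₂) hu hu₂ hn (by
      rw [← neg_eq_zero, ← hk]
      simp [screwMoment, inner_coord]
      ring)
    exact hS.isRoundSphere hconn hu hu₂ hn (h₁.shift_base hu s) (hst ▸ h₂.shift_base hu₂ t)
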